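/- Let $\mathcal X$ be a finite set and let $P_1,P_2$ be probability distributions on $\mathcal X$. Let $X_1,X_2,\dots$ be i.i.d. samples with distribution $P_i$ under hypothesis $H_i$, and write $P_i$ also for the law of the whole sequence. A hypothesis test consists of a stopping time $\tau$ with respect to the filtration $\sigma(X_1,\dots,X_n)$, $n\ge 0$, and, for each $t$, a partition $\mathcal X^t=A_1^t\sqcup A_2^t$; having collected $\tau$ samples, it accepts $H_i$ if $(X_1,\dots,X_\tau)\in A_i^\tau$. * A pair $(E_1,E_2)\in\mathbb R^2$ is achievable in a fixed-length manner if for every $\delta>0$ there is $N(\delta)\in\mathbb N$ such that for all $n\ge N(\delta)$ there is a test with $\tau\le n$ $P_i$-a.s. for $i=1,2$, $P_1(A_2^\tau)\le e^{-(E_1-\delta)n}$ and $P_2(A_1^\tau)\le e^{-(E_2-\delta)n}$. Let $\mathcal R_{\mathrm{FL}}$ be the set of all such pairs. * For $\gamma\ge0$ and an integer $K\ge1$, $(E_1,E_2)\in\mathbb R^2$ is achievable in a $(\gamma,K)$-almost-fixed-length manner if for every $\delta>0$ there is $N(\delta)\in\mathbb N$ such that for all $n\ge N(\delta)$ there is a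 test with $P_i(\tau>n)\le e^{-\gamma n}$ and $\tau\le Kn$ $P_i$-a.s. for $i=1,2$, $P_1(A_2^\tau)\le e^{-(E_1-\delta)n}$ and $P_2(A_1^\tau)\le e^{-(E_2-\delta)n}$. Let $\mathcal R_{\mathrm{AFL}}^{(\gamma,K)}$ be the set of all such pairs. For $\lambda\in[0,1]$ let $P^{(\lambda)}(x)=P_1(x)^{1-\lambda}P_2(x)^{\lambda}\big/\sum_{a}P_1(a)^{1-\lambda}P_2(a)^{\lambda}$ (with $0^0=1$) be the tilted distribution, and let $D(\cdot\|\cdot)$ denote the Kullback–Leibler divergence. Suppose that there is $\lambda^*\in[0,1]$ for which $P^{(\lambda^*)}$ is defined (i.e. its normalizer is nonzero) and $D(P^{(\lambda^*)}\|P_1)=D(P^{(\lambda^*)}\|P_2)<\infty$ (this is automatic if $P_1$ and $P_2$ have the same support); the common value $D^*$ is the Chernoff exponent. For $\gamma\ge0$ let $$E_1(\gamma)=\max_{\lambda\in[0,1]}\{D(P^{(\lambda)}\|P_1): D(P^{(\lambda)}\|P_2)\ge\gamma\},\qquad E_2(\gamma)=\max_{\lambda\in[0,1]}\{D(P^{(\lambda)}\|P_2):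 D(P^{(\lambda)}\|P_1)\ge\gamma\},$$ read as suprema, with value $0$ if no $\lambda$ satisfies the constraint. **Corollary.** If $\gamma>D^*$, then $\mathcal R_{\mathrm{AFL}}^{(\gamma,K)}=\mathcal R_{\mathrm{FL}}$ for every integer $K\ge1$; moreover $$\{E_1: E_1\le E_1(\gamma)\}\times\{E_2: E_2\le E_2(\gamma)\}\subset\mathcal R_{\mathrm{FL}}.$$ -/

import Mathlib

open MeasureTheory InformationTheory

noncomputable section

namespace AFLTest

variable {X : Type*} [MeasurableSpace X]

/-- The `σ`-algebra `σ(X₁, …, Xₙ)` generated by the first `n` samples, for each `n`; the samples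
are the coordinates of `ω : ℕ → X`, numbered from `0`. -/
def sampleFiltration (X : Type*) [MeasurableSpace X] :
    Filtration ℕ (inferInstance : MeasurableSpace (ℕ → X)) where
  seq n := MeasurableSpace.comap (fun (ω : ℕ → X) (i : Fin n) => ω i) inferInstance
  mono' := by
    intro m n hmn
    have hg : Measurable (fun (v : Fin n → X) (i : Fin m) => v (Fin.castLE hmn i)) :=
      measurable_pi_lambda _ fun i => measurable_pi_apply _
    have hcomp : (fun (ω : ℕ → X) (i : Fin m) => ω i) =
        (fun (v : Fin n → X) (i : Fin m) => v (Fin.castLE hmn i)) ∘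
          (fun (ω : ℕ → X) (i : Fin n) => ω i) := rfl
    change MeasurableSpace.comap _ _ ≤ MeasurableSpace.comap _ _
    rw [hcomp, ← MeasurableSpace.comap_comp]
    exact MeasurableSpace.comap_mono hg.comap_le
  le' n := by
    have h : Measurable (fun (ω : ℕ → X) (i : Fin n) => ω i) :=
      measurable_pi_lambda _ fun i => measurable_pi_apply _
    exact h.comap_le

/-- A binary hypothesis test: a stopping time `τ` of the sample filtration and, for every number
`t` of samples, the region `A₁ᵗ ⊆ Xᵗ` in which the test chooses `H₁`. In the complementary region
`A₂ᵗ` it chooses `H₂`. -/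
structure HypothesisTest (X : Type*) [MeasurableSpace X] where
  /-- the number of samples that are collected -/
  τ : (ℕ → X) → WithTop ℕ
  isStoppingTime : IsStoppingTime (sampleFiltration X) τ
  /-- the decision regions `A₁ᵗ` -/
  region₁ : (t : ℕ) → Set (Fin t → X)

/-- The event `A₁^τ` that the test stops and chooses `H₁`. -/
def HypothesisTest.accept₁ (T : HypothesisTest X) : Set (ℕ → X) :=
  {ω | ∃ t : ℕ, T.τ ω = t ∧ (fun i : Fin t => ω i) ∈ T.region₁ t}

/-- The event `A₂^τ` that the test stops and chooses `H₂`. -/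
def HypothesisTest.accept₂ (T : HypothesisTest X) : Set (ℕ → X) :=
  {ω | ∃ t : ℕ, T.τ ω = t ∧ (fun i : Fin t => ω i) ∉ T.region₁ t}

/-- The law of an i.i.d. sequence of samples with distribution `P`. -/
def iidLaw (P : Measure X) [IsProbabilityMeasure P] : Measure (ℕ → X) :=
  Measure.infinitePi (fun _ : ℕ => P)

/-- `(E₁, E₂)` is achievable in a fixed-length manner. -/
def FLAchievable (P₁ P₂ : Measure X) [IsProbabilityMeasure P₁] [IsProbabilityMeasure P₂]
    (E₁ E₂ : ℝ) : Prop :=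
  ∀ δ : ℝ, 0 < δ → ∃ N : ℕ, ∀ n : ℕ, N ≤ n → ∃ T : HypothesisTest X,
    (∀ᵐ ω ∂(iidLaw P₁), T.τ ω ≤ (n : WithTop ℕ)) ∧
    (∀ᵐ ω ∂(iidLaw P₂), T.τ ω ≤ (n : WithTop ℕ)) ∧
    (iidLaw P₁).real T.accept₂ ≤ Real.exp (-(E₁ - δ) * n) ∧
    (iidLaw P₂).real T.accept₁ ≤ Real.exp (-(E₂ - δ) * n)

/-- `(E₁, E₂)` is achievable in a `(γ, K)`-almost-fixed-length manner. -/
def AFLAchievable (P₁ P₂ : Measure X) [IsProbabilityMeasure P₁] [IsProbabilityMeasure P₂]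
    (γ : ℝ) (K : ℕ) (E₁ E₂ : ℝ) : Prop :=
  ∀ δ : ℝ, 0 < δ → ∃ N : ℕ, ∀ n : ℕ, N ≤ n → ∃ T : HypothesisTest X,
    (iidLaw P₁).real {ω | (n : WithTop ℕ) < T.τ ω} ≤ Real.exp (-γ * n) ∧
    (iidLaw P₂).real {ω | (n : WithTop ℕ) < T.τ ω} ≤ Real.exp (-γ * n) ∧
    (∀ᵐ ω ∂(iidLaw P₁), T.τ ω ≤ ((K * n : ℕ) : WithTop ℕ)) ∧
    (∀ᵐ ω ∂(iidLaw P₂), T.τ ω ≤ ((K * n : ℕ) : WithTop ℕ)) ∧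
    (iidLaw P₁).real T.accept₂ ≤ Real.exp (-(E₁ - δ) * n) ∧
    (iidLaw P₂).real T.accept₁ ≤ Real.exp (-(E₂ - δ) * n)

/-- The fixed-length region `R_FL`. -/
def regionFL (P₁ P₂ : Measure X) [IsProbabilityMeasure P₁] [IsProbabilityMeasure P₂] :
    Set (ℝ × ℝ) :=
  {E | FLAchievable P₁ P₂ E.1 E.2}

/-- The almost-fixed-length region `R_AFL^(γ, K)`. -/
def regionAFL (P₁ P₂ : Measure X) [IsProbabilityMeasure P₁] [IsProbabilityMeasure P₂]
    (γ : ℝ) (K : ℕ) : Set (ℝ × ℝ) :=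
  {E | AFLAchievable P₁ P₂ γ K E.1 E.2}

/-- The normalizer `∑ₐ P₁(a)^(1-l) P₂(a)^l` of the tilted distribution (with `0 ^ 0 = 1`). -/
def tiltNormalizer [Fintype X] (P₁ P₂ : Measure X) (l : ℝ) : ℝ :=
  ∑ a : X, P₁.real {a} ^ (1 - l) * P₂.real {a} ^ l

/-- The `l`-tilted distribution `P^(l)`, with mass
`P₁(x)^(1-l) P₂(x)^l / ∑ₐ P₁(a)^(1-l) P₂(a)^l` at `x`. -/
def tilted [Fintype X] (P₁ P₂ : Measure X) (l : ℝ) : Measure X :=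
  ∑ x : X, ENNReal.ofReal (P₁.real {x} ^ (1 - l) * P₂.real {x} ^ l / tiltNormalizer P₁ P₂ l) •
    Measure.dirac x

/-- `D` is the Chernoff exponent `D*` of `P₁` and `P₂`: there is `l* ∈ [0, 1]` for which
`P^(l*)` exists (its normalizer is not zero) and
`D(P^(l*) ‖ P₁) = D(P^(l*) ‖ P₂)`, and `D` is this common value. -/
def IsChernoffExponent [Fintype X] (P₁ P₂ : Measure X) (D : ℝ) : Prop :=
  ∃ l ∈ Set.Icc (0 : ℝ) 1, 0 < tiltNormalizer P₁ P₂ l ∧ 0 ≤ D ∧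
    klDiv (tilted P₁ P₂ l) P₁ = ENNReal.ofReal D ∧
    klDiv (tilted P₁ P₂ l) P₂ = ENNReal.ofReal D

/-- `E₁(γ)`, the maximum of `D(P^(l) ‖ P₁)` over the `l ∈ [0, 1]` with `D(P^(l) ‖ P₂) ≥ γ`;
it is `0` if there is no such `l`. -/
def expo₁ [Fintype X] (P₁ P₂ : Measure X) (γ : ℝ) : ENNReal :=
  sSup {d | ∃ l ∈ Set.Icc (0 : ℝ) 1, ENNReal.ofReal γ ≤ klDiv (tilted P₁ P₂ l) P₂ ∧
    d = klDiv (tilted P₁ P₂ l) P₁}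

/-- `E₂(γ)`, the maximum of `D(P^(l) ‖ P₂)` over the `l ∈ [0, 1]` with `D(P^(l) ‖ P₁) ≥ γ`;
it is `0` if there is no such `l`. -/
def expo₂ [Fintype X] (P₁ P₂ : Measure X) (γ : ℝ) : ENNReal :=
  sSup {d | ∃ l ∈ Set.Icc (0 : ℝ) 1, ENNReal.ofReal γ ≤ klDiv (tilted P₁ P₂ l) P₁ ∧
    d = klDiv (tilted P₁ P₂ l) P₂}

/-- The box `{E₁ : E₁ ≤ E₁(γ)} × {E₂ : E₂ ≤ E₂(γ)}`. -/
def gammaBox [Fintype X] (P₁ P₂ : Measure X) (γ : ℝ) : Set (ℝ × ℝ) :=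
  {E | (E.1 : EReal) ≤ (expo₁ P₁ P₂ γ : EReal) ∧ (E.2 : EReal) ≤ (expo₂ P₁ P₂ γ : EReal)}

end AFLTest

end

open MeasureTheory InformationTheory ProbabilityTheory Filter Topology

namespace AFLTest

/-! Write Z(l) for the normalizer of the geometric mixture. Gibbs' inequality gives -log Z(l) ≤
(1-l) D(Q‖P₁) + l D(Q‖P₂) for every Q with finite divergences, with equality when Q is the tilted
distribution P^(l) (`neg_log_tiltNormalizer_le`, `convexComb_klDiv_tilted`). Taking Q = P^(l*) shows
that -log Z(l) ≤ D* for all l, with equality at l*.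

Box. If P^(l) is at divergence at least γ > D* from one hypothesis, then, the weighted mean of the
two divergences being at most D*, it is within D* of the other. So E₁(γ) and E₂(γ) are at most D*,
and the maximum likelihood test attains the pair (D*, D*) because min(a, b) ≤ a^(1-l) b^l bounds
both of its errors by Z(l*)^n.

Regions. A fixed-length test is almost-fixed-length. Conversely, stop an almost-fixed-length test at
time n and give the undecided sequences to one hypothesis; only one error grows, by at most e^(-γn),
which is harmless if the corresponding exponent is at most γ. If both exponents exceed γ, truncation
makes both errors decay faster than e^(-nD*). That is impossible: P^(l*) is at divergence D* from
both hypotheses, so a change of measure bounds the sum of the errors from below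
(`eventually_half_exp_le_error_sum`). -/

/-- The first `n` samples. -/
def prefixMap (X : Type*) (n : ℕ) (ω : ℕ → X) : Fin n → X := fun i => ω i

lemma measurable_prefixMap {X : Type*} [MeasurableSpace X] (n : ℕ) :
    Measurable (prefixMap X n) :=
  measurable_pi_lambda _ fun _ => measurable_pi_apply _

instance {X : Type*} [MeasurableSpace X] (P : Measure X) [IsProbabilityMeasure P] :
    IsProbabilityMeasure (iidLaw P) := by
  unfold iidLaw
  infer_instance

lemma iidLaw_prefix_singleton {X : Type*} [MeasurableSpace X] [MeasurableSingletonClass X]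
    (P : Measure X) [IsProbabilityMeasure P] {n : ℕ} (v : Fin n → X) :
    (iidLaw P).real (prefixMap X n ⁻¹' {v}) = ∏ i, P.real {v i} := by
  have hset : prefixMap X n ⁻¹' {v} = Set.pi (Finset.range n : Finset ℕ)
      (fun i => if h : i < n then {v ⟨i, h⟩} else Set.univ) := by
    ext ω
    simp only [Set.mem_preimage, Set.mem_singleton_iff, funext_iff, prefixMap, Set.mem_pi,
      Finset.coe_range, Set.mem_Iio]
    constructor
    · intro h i hi
      simpa [hi] using h ⟨i, hi⟩
    · intro h i
      simpa using h i i.2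
  rw [measureReal_def, hset, iidLaw, Measure.infinitePi_pi, Finset.prod_range, ENNReal.toReal_prod]
  · simp [measureReal_def]
  · intro i _
    split_ifs
    · exact measurableSet_singleton _
    · exact MeasurableSet.univ

open Classical in
lemma iidLaw_prefix {X : Type*} [Fintype X] [MeasurableSpace X] [MeasurableSingletonClass X]
    (P : Measure X) [IsProbabilityMeasure P] {n : ℕ} (C : Set (Fin n → X)) :
    (iidLaw P).real (prefixMap X n ⁻¹' C) = ∑ v ∈ C.toFinset, ∏ i, P.real {v i} := by
  have h := sum_measureReal_preimage_singleton (μ := iidLaw P) (f := prefixMap X n) C.toFinset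
    (fun v _ => measurable_prefixMap n (measurableSet_singleton v))
  rw [Set.coe_toFinset] at h
  rw [← h]
  exact Finset.sum_congr rfl fun v _ => iidLaw_prefix_singleton P v

/-! ### Divergences on a finite alphabet and the geometric mixture -/

section KullbackLeibler

lemma absolutelyContinuous_of_real_singleton {X : Type*} [Fintype X] [MeasurableSpace X]
    (Q P : Measure X) [IsProbabilityMeasure Q] [IsProbabilityMeasure P] (h : ∀ x, P.real {x} = 0 → Q.real {x} = 0) : Q ≪ P := by
  intro s hs
  have : s = ⋃ x ∈ s, {x} := by simp
  rw [this, measure_biUnion_null_iff s.to_countable]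
  intro x hx
  rw [← measureReal_eq_zero_iff]
  exact h x ((measureReal_eq_zero_iff).2 (measure_mono_null (by simpa using hx) hs))

/-- Gibbs' inequality against an unnormalized weight. -/
lemma sum_mul_log_div_le {X : Type*} [Fintype X] {q w : X → ℝ} (hq : ∀ x, 0 ≤ q x) (hq1 : ∑ x, q x = 1)
    (hw : ∀ x, 0 ≤ w x) (hqw : ∀ x, w x = 0 → q x = 0) :
    -Real.log (∑ x, w x) ≤ ∑ x, q x * Real.log (q x / w x) := by
  have hZ : 0 < ∑ x, w x := by
    refine lt_of_le_of_ne (Finset.sum_nonneg fun x _ => hw x) fun h0 => ?_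
    have hw0 := (Finset.sum_eq_zero_iff_of_nonneg fun x _ => hw x).1 h0.symm
    have : ∑ x, q x = 0 := Finset.sum_eq_zero fun x hx => hqw x (hw0 x hx)
    linarith
  set Z := ∑ x, w x
  have key : ∀ x, q x - w x / Z - q x * Real.log Z ≤ q x * Real.log (q x / w x) := by
    intro x
    rcases (hq x).eq_or_lt with h0 | hpos
    · simp only [← h0, zero_mul, zero_sub, sub_zero, Left.neg_nonpos_iff]
      exact div_nonneg (hw x) hZ.le
    have hwx : 0 < w x := lt_of_le_of_ne (hw x) fun h => hpos.ne' (hqw x h.symm)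
    -- The inequality log t ≤ t - 1 at t = w/(Zq), the ratio of the normalized weight to q.
    have h1 := Real.log_le_sub_one_of_pos (show 0 < w x / Z / q x by positivity)
    rw [Real.log_div (by positivity) (by positivity), Real.log_div (by positivity) (by positivity)]
      at h1
    rw [Real.log_div (by positivity) (by positivity)]
    have h2 := mul_le_mul_of_nonneg_left h1 hpos.le
    have h3 : q x * (w x / Z / q x - 1) = w x / Z - q x := by field_simp
    rw [h3] at h2
    linarith
  have := Finset.sum_le_sum fun x (_ : x ∈ Finset.univ) => key x
  rw [Finset.sum_sub_distrib, Finset.sum_sub_distrib, ← Finset.sum_div, ← Finset.sum_mul, hq1,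
    div_self hZ.ne'] at this
  linarith

lemma tiltWeight_nonneg {X : Type*} [MeasurableSpace X] (P₁ P₂ : Measure X) (l : ℝ) (x : X) :
    0 ≤ P₁.real {x} ^ (1 - l) * P₂.real {x} ^ l := by positivity

variable {X : Type*} [Fintype X] [MeasurableSpace X] [MeasurableSingletonClass X]

lemma sum_real_singleton (P : Measure X) [IsProbabilityMeasure P] : ∑ x, P.real {x} = 1 := by
  rw [sum_measureReal_singleton]
  simp

lemma integral_llr_eq_sum (Q P : Measure X) [IsProbabilityMeasure Q] [IsProbabilityMeasure P]
    (h : Q ≪ P) :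
    ∫ x, llr Q P x ∂Q = ∑ x, Q.real {x} * Real.log (Q.real {x} / P.real {x}) := by
  rw [integral_fintype .of_finite]
  refine Finset.sum_congr rfl fun x _ => ?_
  rcases eq_or_ne (Q {x}) 0 with hx | hx
  · simp [measureReal_def, hx]
  have hp : P {x} ≠ 0 := fun h0 => hx (h h0)
  have hd : Q.rnDeriv P x * P {x} = Q {x} := by
    conv_rhs => rw [← Measure.withDensity_rnDeriv_eq Q P h]
    rw [withDensity_apply _ (measurableSet_singleton x), lintegral_singleton]
  have hpr : (P {x}).toReal ≠ 0 := (ENNReal.toReal_pos hp (measure_ne_top _ _)).ne'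
  rw [llr, smul_eq_mul, measureReal_def, measureReal_def, ← hd, ENNReal.toReal_mul,
    mul_div_cancel_right₀ _ hpr]

/-- A finite divergence on a finite alphabet is given by the usual sum. -/
lemma klDiv_eq_ofReal_sum (Q P : Measure X) [IsProbabilityMeasure Q] [IsProbabilityMeasure P]
    (h : klDiv Q P ≠ ⊤) :
    (∀ x, P.real {x} = 0 → Q.real {x} = 0) ∧
      (klDiv Q P).toReal = ∑ x, Q.real {x} * Real.log (Q.real {x} / P.real {x}) := by
  have hac := (klDiv_ne_top_iff.1 h).1
  refine ⟨fun x hx => ?_, ?_⟩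
  · rw [measureReal_eq_zero_iff] at hx ⊢
    exact hac hx
  · rw [toReal_klDiv_of_measure_eq hac (by simp), integral_llr_eq_sum Q P hac]

lemma klDiv_ne_top_of_real_singleton (Q P : Measure X) [IsProbabilityMeasure Q]
    [IsProbabilityMeasure P] (h : ∀ x, P.real {x} = 0 → Q.real {x} = 0) : klDiv Q P ≠ ⊤ :=
  klDiv_ne_top (absolutelyContinuous_of_real_singleton Q P h) .of_finite

lemma tilted_real_singleton (P₁ P₂ : Measure X) (l : ℝ) (x : X) :
    (tilted P₁ P₂ l).real {x} =
      P₁.real {x} ^ (1 - l) * P₂.real {x} ^ l / tiltNormalizer P₁ P₂ l := by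
  classical
  have h0 : 0 ≤ tiltNormalizer P₁ P₂ l := Finset.sum_nonneg fun x _ => tiltWeight_nonneg P₁ P₂ l x
  rw [measureReal_def, tilted, Measure.finsetSum_apply, Finset.sum_eq_single x]
  · simp only [Measure.smul_apply, smul_eq_mul]
    rw [Measure.dirac_apply_of_mem (Set.mem_singleton x), mul_one, ENNReal.toReal_ofReal]
    exact div_nonneg (tiltWeight_nonneg P₁ P₂ l x) h0
  · intro y _ hy
    simp [Measure.dirac_apply' _ (measurableSet_singleton x), hy]
  · simp

lemma isProbabilityMeasure_tilted (P₁ P₂ : Measure X) (l : ℝ) (h : 0 < tiltNormalizer P₁ P₂ l) :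
    IsProbabilityMeasure (tilted P₁ P₂ l) := by
  have : IsFiniteMeasure (tilted P₁ P₂ l) := by
    refine ⟨?_⟩
    rw [tilted, Measure.finsetSum_apply]
    simp
  constructor
  have h1 : (tilted P₁ P₂ l).real Set.univ = 1 := by
    rw [← Finset.coe_univ, ← sum_measureReal_singleton]
    simp_rw [tilted_real_singleton]
    rw [← Finset.sum_div]
    exact div_self h.ne'
  rw [measureReal_def] at h1
  rwa [ENNReal.toReal_eq_one_iff] at h1

lemma tilted_zero (P₁ P₂ : Measure X) [IsProbabilityMeasure P₁] : tilted P₁ P₂ 0 = P₁ := by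
  have hz : tiltNormalizer P₁ P₂ 0 = 1 := by simp [tiltNormalizer]
  have := isProbabilityMeasure_tilted P₁ P₂ 0 (by rw [hz]; exact one_pos)
  refine Measure.ext_of_singleton fun x => ?_
  rw [← ENNReal.toReal_eq_toReal_iff' (measure_ne_top _ _) (measure_ne_top _ _)]
  have := tilted_real_singleton P₁ P₂ 0 x
  simpa [hz, measureReal_def] using this

lemma tilted_one (P₁ P₂ : Measure X) [IsProbabilityMeasure P₂] : tilted P₁ P₂ 1 = P₂ := by
  have hz : tiltNormalizer P₁ P₂ 1 = 1 := by simp [tiltNormalizer]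
  have := isProbabilityMeasure_tilted P₁ P₂ 1 (by rw [hz]; exact one_pos)
  refine Measure.ext_of_singleton fun x => ?_
  rw [← ENNReal.toReal_eq_toReal_iff' (measure_ne_top _ _) (measure_ne_top _ _)]
  have := tilted_real_singleton P₁ P₂ 1 x
  simpa [hz, measureReal_def] using this

/-- The convex combination of two divergences as a divergence from the geometric mixture. -/
lemma convexComb_klDiv (Q P₁ P₂ : Measure X) [IsProbabilityMeasure Q] [IsProbabilityMeasure P₁]
    [IsProbabilityMeasure P₂] (h₁ : klDiv Q P₁ ≠ ⊤) (h₂ : klDiv Q P₂ ≠ ⊤) (l : ℝ) :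
    (1 - l) * (klDiv Q P₁).toReal + l * (klDiv Q P₂).toReal =
      ∑ x, Q.real {x} * Real.log (Q.real {x} / (P₁.real {x} ^ (1 - l) * P₂.real {x} ^ l)) := by
  obtain ⟨ha, ha'⟩ := klDiv_eq_ofReal_sum Q P₁ h₁
  obtain ⟨hb, hb'⟩ := klDiv_eq_ofReal_sum Q P₂ h₂
  rw [ha', hb', Finset.mul_sum, Finset.mul_sum, ← Finset.sum_add_distrib]
  refine Finset.sum_congr rfl fun x _ => ?_
  rcases eq_or_ne (Q.real {x}) 0 with h0 | h0
  · simp [h0]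
  have p1 : 0 < P₁.real {x} := lt_of_le_of_ne measureReal_nonneg fun h => h0 (ha x h.symm)
  have p2 : 0 < P₂.real {x} := lt_of_le_of_ne measureReal_nonneg fun h => h0 (hb x h.symm)
  rw [Real.log_div h0 p1.ne', Real.log_div h0 p2.ne', Real.log_div h0 (by positivity),
    Real.log_mul (by positivity) (by positivity), Real.log_rpow p1, Real.log_rpow p2]
  ring

/-- Gibbs' inequality against the weight P₁^(1-l) P₂^l. Finite divergences make Q vanish wherever
this weight does. -/
lemma neg_log_tiltNormalizer_le (Q P₁ P₂ : Measure X) [IsProbabilityMeasure Q]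
    [IsProbabilityMeasure P₁] [IsProbabilityMeasure P₂] (h₁ : klDiv Q P₁ ≠ ⊤)
    (h₂ : klDiv Q P₂ ≠ ⊤) (l : ℝ) :
    -Real.log (tiltNormalizer P₁ P₂ l) ≤
      (1 - l) * (klDiv Q P₁).toReal + l * (klDiv Q P₂).toReal := by
  rw [convexComb_klDiv Q P₁ P₂ h₁ h₂]
  refine sum_mul_log_div_le (fun _ => measureReal_nonneg) (sum_real_singleton Q)
    (tiltWeight_nonneg P₁ P₂ l) fun x hx => ?_
  rcases mul_eq_zero.1 hx with h | h
  · exact (klDiv_eq_ofReal_sum Q P₁ h₁).1 x ((Real.rpow_eq_zero_iff_of_nonneg measureReal_nonneg).1 h).1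
  · exact (klDiv_eq_ofReal_sum Q P₂ h₂).1 x ((Real.rpow_eq_zero_iff_of_nonneg measureReal_nonneg).1 h).1

/-- The equality case of Gibbs' inequality: on its support, P^(l) divided by its weight is the
constant 1/Z(l). -/
lemma convexComb_klDiv_tilted (P₁ P₂ : Measure X) [IsProbabilityMeasure P₁]
    [IsProbabilityMeasure P₂] {l : ℝ} (hZ : 0 < tiltNormalizer P₁ P₂ l)
    (h₁ : klDiv (tilted P₁ P₂ l) P₁ ≠ ⊤) (h₂ : klDiv (tilted P₁ P₂ l) P₂ ≠ ⊤) :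
    (1 - l) * (klDiv (tilted P₁ P₂ l) P₁).toReal + l * (klDiv (tilted P₁ P₂ l) P₂).toReal =
      -Real.log (tiltNormalizer P₁ P₂ l) := by
  have := isProbabilityMeasure_tilted P₁ P₂ l hZ
  rw [convexComb_klDiv _ P₁ P₂ h₁ h₂]
  have key : ∀ x, (tilted P₁ P₂ l).real {x} * Real.log ((tilted P₁ P₂ l).real {x} /
      (P₁.real {x} ^ (1 - l) * P₂.real {x} ^ l)) =
      (tilted P₁ P₂ l).real {x} * -Real.log (tiltNormalizer P₁ P₂ l) := by
    intro x
    rw [tilted_real_singleton]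
    rcases eq_or_ne (P₁.real {x} ^ (1 - l) * P₂.real {x} ^ l) 0 with h0 | h0
    · simp [h0]
    rw [div_right_comm, div_self h0, one_div, Real.log_inv]
  rw [Finset.sum_congr rfl fun x _ => key x, ← Finset.sum_mul, sum_real_singleton, one_mul]

/-- For interior l both exponents are positive, so the weight vanishes where either distribution
does. At an endpoint the convention 0^0 = 1 destroys this. -/
lemma klDiv_tilted_ne_top (P₁ P₂ : Measure X) [IsProbabilityMeasure P₁]
    [IsProbabilityMeasure P₂] {l : ℝ} (hZ : 0 < tiltNormalizer P₁ P₂ l) (h0 : 0 < l) (h1 : l < 1) :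
    klDiv (tilted P₁ P₂ l) P₁ ≠ ⊤ ∧ klDiv (tilted P₁ P₂ l) P₂ ≠ ⊤ := by
  have := isProbabilityMeasure_tilted P₁ P₂ l hZ
  constructor <;> refine klDiv_ne_top_of_real_singleton _ _ fun x hx => ?_
  · rw [tilted_real_singleton, hx, Real.zero_rpow (by linarith)]
    simp
  · rw [tilted_real_singleton, hx, Real.zero_rpow h0.ne']
    simp

/-- The normalizer is positive as soon as some distribution has finite divergence from both. -/
lemma tiltNormalizer_pos (Q P₁ P₂ : Measure X) [IsProbabilityMeasure Q]
    [IsProbabilityMeasure P₁] [IsProbabilityMeasure P₂] (h₁ : klDiv Q P₁ ≠ ⊤)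
    (h₂ : klDiv Q P₂ ≠ ⊤) (l : ℝ) : 0 < tiltNormalizer P₁ P₂ l := by
  obtain ⟨x, -, hx⟩ : ∃ x ∈ Finset.univ, Q.real {x} ≠ 0 := by
    refine Finset.exists_ne_zero_of_sum_ne_zero ?_
    rw [sum_real_singleton]
    exact one_ne_zero
  have p1 : 0 < P₁.real {x} := lt_of_le_of_ne measureReal_nonneg fun h =>
    hx ((klDiv_eq_ofReal_sum Q P₁ h₁).1 x h.symm)
  have p2 : 0 < P₂.real {x} := lt_of_le_of_ne measureReal_nonneg fun h =>
    hx ((klDiv_eq_ofReal_sum Q P₂ h₂).1 x h.symm)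
  exact Finset.sum_pos' (fun y _ => tiltWeight_nonneg P₁ P₂ l y) ⟨x, Finset.mem_univ x, by positivity⟩

end KullbackLeibler

/-! ### Fixed-length tests as sets of words of length n -/

section FixedLength

/-- The test that always collects `n` samples and rejects `H₁` on `C`. -/
def fixedLengthTest {X : Type*} [MeasurableSpace X] (n : ℕ) (C : Set (Fin n → X)) :
    HypothesisTest X where
  τ := fun _ => (n : WithTop ℕ)
  isStoppingTime := isStoppingTime_const _ n
  -- Since τ is constantly n, only the region at t = n is ever consulted.
  region₁ t := {v | ∃ h : t = n, (fun i : Fin n => v (Fin.cast h.symm i)) ∉ C}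

lemma fixedLengthTest_accept₁ {X : Type*} [MeasurableSpace X] (n : ℕ) (C : Set (Fin n → X)) :
    (fixedLengthTest n C).accept₁ = prefixMap X n ⁻¹' Cᶜ := by
  ext ω
  constructor
  · rintro ⟨t, -, rfl, h⟩
    exact h
  · exact fun h => ⟨n, rfl, rfl, h⟩

lemma fixedLengthTest_accept₂ {X : Type*} [MeasurableSpace X] (n : ℕ) (C : Set (Fin n → X)) :
    (fixedLengthTest n C).accept₂ = prefixMap X n ⁻¹' C := by
  ext ω
  constructor
  · rintro ⟨t, ht, h⟩
    have htn : n = t := WithTop.coe_injective ht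
    subst htn
    by_contra hC
    exact h ⟨rfl, hC⟩
  · intro h
    refine ⟨n, rfl, ?_⟩
    rintro ⟨_, hC⟩
    exact hC h

variable {X : Type*} [MeasurableSpace X] (P₁ P₂ : Measure X)
  [IsProbabilityMeasure P₁] [IsProbabilityMeasure P₂]

lemma flAchievable_of_eventually_exists_set {E₁ E₂ : ℝ}
    (h : ∀ δ : ℝ, 0 < δ → ∀ᶠ n : ℕ in atTop, ∃ C : Set (Fin n → X),
      (iidLaw P₁).real (prefixMap X n ⁻¹' C) ≤ Real.exp (-(E₁ - δ) * n) ∧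
      (iidLaw P₂).real (prefixMap X n ⁻¹' Cᶜ) ≤ Real.exp (-(E₂ - δ) * n)) :
    FLAchievable P₁ P₂ E₁ E₂ := by
  intro δ hδ
  obtain ⟨N, hN⟩ := eventually_atTop.1 (h δ hδ)
  refine ⟨N, fun n hn => ?_⟩
  obtain ⟨C, h₁, h₂⟩ := hN n hn
  refine ⟨fixedLengthTest n C, ae_of_all _ fun _ => le_rfl, ae_of_all _ fun _ => le_rfl, ?_, ?_⟩
  · rwa [fixedLengthTest_accept₂]
  · rwa [fixedLengthTest_accept₁]

end FixedLength

/-! ### Truncation of a test at time n -/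

section Truncation

variable {X : Type*} [MeasurableSpace X]

/-- An event known by time `n` is determined by the first `n` samples. -/
lemma exists_prefixMap_preimage_eq {n : ℕ} {S : Set (ℕ → X)}
    (hS : MeasurableSet[sampleFiltration X n] S) : ∃ C, prefixMap X n ⁻¹' C = S := by
  obtain ⟨C, -, hC⟩ := hS
  exact ⟨C, hC⟩

/-- A decision taken by time n depends on the first n samples only. The regions `R` are arbitrary so
that either decision can be treated. -/
lemma measurableSet_accept_inter_le [DiscreteMeasurableSpace X] [Finite X] (T : HypothesisTest X)
    (n : ℕ) (R : (t : ℕ) → Set (Fin t → X)) :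
    MeasurableSet[sampleFiltration X n]
      {ω | ∃ t : ℕ, t ≤ n ∧ T.τ ω = t ∧ (fun i : Fin t => ω i) ∈ R t} := by
  have : {ω | ∃ t : ℕ, t ≤ n ∧ T.τ ω = t ∧ (fun i : Fin t => ω i) ∈ R t} =
      ⋃ t ∈ Set.Iic n, ({ω | T.τ ω = t} ∩ (fun (ω : ℕ → X) (i : Fin t) => ω i) ⁻¹' R t) := by
    ext ω
    simp only [Set.mem_ofPred_eq, Set.mem_iUnion, Set.mem_inter_iff, Set.mem_preimage,
      Set.mem_Iic, exists_prop]
  rw [this]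
  refine MeasurableSet.biUnion (Set.to_countable _) fun t ht => ?_
  refine (sampleFiltration X).mono ht _ ?_
  exact (T.isStoppingTime.measurableSet_eq t).inter ⟨R t, (R t).toFinite.measurableSet, rfl⟩

variable (P₁ P₂ : Measure X) [IsProbabilityMeasure P₁] [IsProbabilityMeasure P₂]

/-- The bound τ ≤ Kn enters the converse inclusion only through this finiteness. -/
lemma ae_exists_eq_natCast {P : Measure (ℕ → X)} {τ : (ℕ → X) → WithTop ℕ} {M : ℕ}
    (h : ∀ᵐ ω ∂P, τ ω ≤ (M : WithTop ℕ)) : ∀ᵐ ω ∂P, ∃ t : ℕ, τ ω = t := by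
  filter_upwards [h] with ω hω
  obtain ⟨t, ht, -⟩ := WithTop.le_coe_iff.1 hω
  exact ⟨t, ht⟩

/-- Truncating a test at time `n` in favour of `H₁`. -/
lemma exists_set_truncate₁ [DiscreteMeasurableSpace X] [Finite X] (T : HypothesisTest X) (n : ℕ)
    (h₂ : ∀ᵐ ω ∂(iidLaw P₂), ∃ t : ℕ, T.τ ω = t) :
    ∃ C : Set (Fin n → X),
      (iidLaw P₁).real (prefixMap X n ⁻¹' C) ≤ (iidLaw P₁).real T.accept₂ ∧
      (iidLaw P₂).real (prefixMap X n ⁻¹' Cᶜ) ≤ (iidLaw P₂).real T.accept₁ +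
        (iidLaw P₂).real {ω | (n : WithTop ℕ) < T.τ ω} := by
  obtain ⟨C, hC⟩ := exists_prefixMap_preimage_eq
    (measurableSet_accept_inter_le T n fun t => (T.region₁ t)ᶜ)
  refine ⟨C, measureReal_mono ?_, ?_⟩
  · rw [hC]
    rintro ω ⟨t, -, ht, hR⟩
    exact ⟨t, ht, hR⟩
  · refine le_trans ?_ (measureReal_union_le _ _)
    refine ENNReal.toReal_mono (measure_ne_top _ _) (measure_mono_ae ?_)
    filter_upwards [h₂] with ω hω hωC
    obtain ⟨t, ht⟩ := hω
    have hωC' : ω ∉ prefixMap X n ⁻¹' C := hωC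
    rw [hC] at hωC'
    rcases le_or_gt t n with htn | htn
    · left
      refine ⟨t, ht, ?_⟩
      by_contra hR
      exact hωC' ⟨t, htn, ht, hR⟩
    · right
      change (n : WithTop ℕ) < T.τ ω
      rw [ht]
      exact_mod_cast htn

/-- Truncating a test at time `n` in favour of `H₂`. -/
lemma exists_set_truncate₂ [DiscreteMeasurableSpace X] [Finite X] (T : HypothesisTest X) (n : ℕ)
    (h₁ : ∀ᵐ ω ∂(iidLaw P₁), ∃ t : ℕ, T.τ ω = t) :
    ∃ C : Set (Fin n → X),
      (iidLaw P₁).real (prefixMap X n ⁻¹' C) ≤ (iidLaw P₁).real T.accept₂ +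
        (iidLaw P₁).real {ω | (n : WithTop ℕ) < T.τ ω} ∧
      (iidLaw P₂).real (prefixMap X n ⁻¹' Cᶜ) ≤ (iidLaw P₂).real T.accept₁ := by
  obtain ⟨C, hC⟩ := exists_prefixMap_preimage_eq (measurableSet_accept_inter_le T n T.region₁)
  refine ⟨Cᶜ, ?_, measureReal_mono ?_⟩
  · refine le_trans ?_ (measureReal_union_le _ _)
    refine ENNReal.toReal_mono (measure_ne_top _ _) (measure_mono_ae ?_)
    filter_upwards [h₁] with ω hω hωC
    obtain ⟨t, ht⟩ := hω
    have hωC' : ω ∉ prefixMap X n ⁻¹' C := hωC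
    rw [hC] at hωC'
    rcases le_or_gt t n with htn | htn
    · left
      exact ⟨t, ht, fun hR => hωC' ⟨t, htn, ht, hR⟩⟩
    · right
      change (n : WithTop ℕ) < T.τ ω
      rw [ht]
      exact_mod_cast htn
  · rw [compl_compl, hC]
    rintro ω ⟨t, -, ht, hR⟩
    exact ⟨t, ht, hR⟩

lemma regionFL_subset_regionAFL (γ : ℝ) {K : ℕ} (hK : 1 ≤ K) :
    regionFL P₁ P₂ ⊆ regionAFL P₁ P₂ γ K := by
  rintro ⟨E₁, E₂⟩ h δ hδ
  obtain ⟨N, hN⟩ := h δ hδ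
  refine ⟨N, fun n hn => ?_⟩
  obtain ⟨T, h₁, h₂, h₃, h₄⟩ := hN n hn
  have hle : (n : WithTop ℕ) ≤ ((K * n : ℕ) : WithTop ℕ) := by
    exact_mod_cast Nat.le_mul_of_pos_left n hK
  have hzero : ∀ (P : Measure X) [IsProbabilityMeasure P],
      (∀ᵐ ω ∂(iidLaw P), T.τ ω ≤ (n : WithTop ℕ)) →
      (iidLaw P).real {ω | (n : WithTop ℕ) < T.τ ω} ≤ Real.exp (-γ * n) := by
    intro P _ hP
    have h0 : iidLaw P {ω | (n : WithTop ℕ) < T.τ ω} = 0 := by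
      simpa [ae_iff] using hP
    rw [measureReal_def, h0]
    exact (Real.exp_pos _).le
  exact ⟨T, hzero P₁ h₁, hzero P₂ h₂, h₁.mono fun ω h => h.trans hle,
    h₂.mono fun ω h => h.trans hle, h₃, h₄⟩

end Truncation

/-! ### Change of measure and the lower bound on errors -/

section Converse

lemma prod_real_singleton_le_exp_mul {X : Type*} [MeasurableSpace X] (Q P : Measure X)
    (hac : ∀ x, P.real {x} = 0 → Q.real {x} = 0) {n : ℕ} (v : Fin n → X) {a : ℝ}
    (hv : ∑ i, Real.log (Q.real {v i} / P.real {v i}) ≤ a) :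
    ∏ i, Q.real {v i} ≤ Real.exp a * ∏ i, P.real {v i} := by
  -- A word with a `Q`-null letter has product 0, so the default value of log 0 in the hypothesis
  -- does no harm.
  by_cases h0 : ∃ i, Q.real {v i} = 0
  · obtain ⟨i, hi⟩ := h0
    rw [Finset.prod_eq_zero (Finset.mem_univ i) hi]
    positivity
  push Not at h0
  have hq : ∀ i, 0 < Q.real {v i} := fun i => lt_of_le_of_ne measureReal_nonneg (h0 i).symm
  have hp : ∀ i, 0 < P.real {v i} := fun i =>
    lt_of_le_of_ne measureReal_nonneg fun h => h0 i (hac _ h.symm)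
  have : ∏ i, Q.real {v i} = Real.exp (∑ i, Real.log (Q.real {v i} / P.real {v i})) *
      ∏ i, P.real {v i} := by
    rw [Real.exp_sum, ← Finset.prod_mul_distrib]
    refine Finset.prod_congr rfl fun i _ => ?_
    rw [Real.exp_log (div_pos (hq i) (hp i)), div_mul_cancel₀ _ (hp i).ne']
  rw [this]
  gcongr

variable {X : Type*} [Fintype X] [MeasurableSpace X] [MeasurableSingletonClass X]

/-- The weak law of large numbers, deduced from the strong law; it is applied to the log-likelihood
ratio, whose `Q`-mean is the divergence. -/
lemma tendsto_iidLaw_deviation (Q : Measure X) [IsProbabilityMeasure Q] (f : X → ℝ) {ε : ℝ}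
    (hε : 0 < ε) :
    Tendsto (fun n : ℕ => (iidLaw Q).real
      {ω | ε ≤ dist ((∑ i ∈ Finset.range n, f (ω i)) / n) (∑ x, Q.real {x} * f x)})
      atTop (𝓝 0) := by
  have hf : Measurable f := measurable_of_finite f
  have hind : iIndepFun (fun (i : ℕ) (ω : ℕ → X) => f (ω i)) (iidLaw Q) :=
    iIndepFun_infinitePi (P := fun _ : ℕ => Q) (X := fun _ => f) fun _ => hf
  have hmeas : ∀ i : ℕ, Measurable fun ω : ℕ → X => f (ω i) := fun i =>
    hf.comp (measurable_pi_apply i)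
  have hmap : ∀ i : ℕ, (iidLaw Q).map (fun ω : ℕ → X => f (ω i)) = Q.map f := by
    intro i
    have h := (measurePreserving_eval_infinitePi (fun _ : ℕ => Q) i).map_eq
    conv_rhs => rw [← h, Measure.map_map hf (measurable_pi_apply i)]
    rfl
  have hident : ∀ i : ℕ, IdentDistrib (fun ω : ℕ → X => f (ω i)) (fun ω => f (ω 0))
      (iidLaw Q) (iidLaw Q) := fun i =>
    ⟨(hmeas i).aemeasurable, (hmeas 0).aemeasurable, by rw [hmap, hmap]⟩
  have hint : Integrable (fun ω : ℕ → X => f (ω 0)) (iidLaw Q) :=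
    (measurePreserving_eval_infinitePi (fun _ : ℕ => Q) 0).integrable_comp_of_integrable
      (g := f) .of_finite
  have hmean : ∫ ω, f (ω 0) ∂(iidLaw Q) = ∑ x, Q.real {x} * f x := by
    have h := integral_map (μ := iidLaw Q) (φ := fun ω : ℕ → X => ω 0) (f := f)
      (measurable_pi_apply 0).aemeasurable hf.aestronglyMeasurable
    rw [← h]
    have h' := (measurePreserving_eval_infinitePi (fun _ : ℕ => Q) 0).map_eq
    change ∫ y, f y ∂(Measure.map (Function.eval 0) (Measure.infinitePi fun _ : ℕ => Q)) = _
    rw [h', integral_fintype .of_finite]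
    rfl
  have hlln := strong_law_ae_real (fun (i : ℕ) (ω : ℕ → X) => f (ω i)) hint
    (fun i j hij => hind.indepFun hij) hident
  rw [hmean] at hlln
  have htm := tendstoInMeasure_of_tendsto_ae (μ := iidLaw Q)
    (f := fun (n : ℕ) (ω : ℕ → X) => (∑ i ∈ Finset.range n, f (ω i)) / (n : ℝ))
    (g := fun _ => ∑ x, Q.real {x} * f x)
    (fun n => ((Finset.measurable_sum _ fun i _ => hmeas i).div_const _).aestronglyMeasurable)
    hlln
  rw [tendstoInMeasure_iff_dist] at htm
  have h := (ENNReal.tendsto_toReal ENNReal.zero_ne_top).comp (htm ε hε)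
  simpa [Function.comp_def, measureReal_def] using h

/-- Change of measure: an event of the first `n` samples that is not rare under `Q` has
`P`-probability of exponential order at least `D(Q ‖ P)`. -/
lemma eventually_iidLaw_le_exp_mul (Q P : Measure X) [IsProbabilityMeasure Q]
    [IsProbabilityMeasure P] (h : klDiv Q P ≠ ⊤) {ε : ℝ} (hε : 0 < ε) :
    ∀ᶠ n : ℕ in atTop, ∀ C : Set (Fin n → X), (iidLaw Q).real (prefixMap X n ⁻¹' C) ≤
      Real.exp (n * ((klDiv Q P).toReal + ε)) * (iidLaw P).real (prefixMap X n ⁻¹' C) + 1 / 4 := by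
  classical
  obtain ⟨hac, hD⟩ := klDiv_eq_ofReal_sum Q P h
  set D := (klDiv Q P).toReal
  have hdev := tendsto_iidLaw_deviation Q (fun x => Real.log (Q.real {x} / P.real {x})) hε
  rw [← hD] at hdev
  filter_upwards [hdev.eventually_le_const (show (0 : ℝ) < 1 / 4 by norm_num),
    eventually_gt_atTop 0] with n hn hn0 C
  have hn0' : (0 : ℝ) < n := by exact_mod_cast hn0
  -- Words whose log-likelihood ratio is not too large. On `G` the measure changes at cost
  -- e^(n(D+ε)); its complement has `Q`-probability at most 1/4, uniformly in `C`.
  set G : Set (Fin n → X) := {v | ∑ i, Real.log (Q.real {v i} / P.real {v i}) ≤ n * (D + ε)}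
  refine le_trans (le_trans (measureReal_mono (s₂ := prefixMap X n ⁻¹' (C ∩ G) ∪
    {ω | ε ≤ dist ((∑ i ∈ Finset.range n, Real.log (Q.real {ω i} / P.real {ω i})) / n) D}) ?_)
    (measureReal_union_le _ _)) (add_le_add ?_ hn)
  · intro ω hω
    by_cases hG : prefixMap X n ω ∈ G
    · exact Or.inl ⟨hω, hG⟩
    · right
      have hG' : n * (D + ε) < ∑ i : Fin n, Real.log (Q.real {ω i} / P.real {ω i}) := not_le.1 hG
      rw [← Finset.sum_range fun i => Real.log (Q.real {ω i} / P.real {ω i}), mul_comm,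
        ← lt_div_iff₀ hn0'] at hG'
      change ε ≤ dist _ D
      rw [Real.dist_eq]
      exact le_trans (by linarith) (le_abs_self _)
  · rw [iidLaw_prefix, iidLaw_prefix, Finset.mul_sum]
    refine le_trans (Finset.sum_le_sum fun v hv =>
      prod_real_singleton_le_exp_mul Q P hac v ((@Set.mem_toFinset _ _ (_) _).1 hv).2) ?_
    exact Finset.sum_le_sum_of_subset_of_nonneg
      (fun v hv => Set.mem_toFinset.2 ((@Set.mem_toFinset _ _ (_) _).1 hv).1) fun v _ _ =>
        mul_nonneg (Real.exp_pos _).le (Finset.prod_nonneg fun i _ => measureReal_nonneg)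

/-- The converse to Chernoff's theorem: the two error probabilities of a fixed-length test cannot
both decay faster than `exp (-n D)` if some `Q` is within divergence `D` of both hypotheses. -/
lemma eventually_half_exp_le_error_sum (Q P₁ P₂ : Measure X) [IsProbabilityMeasure Q]
    [IsProbabilityMeasure P₁] [IsProbabilityMeasure P₂] {D : ℝ} (hD : 0 ≤ D)
    (h₁ : klDiv Q P₁ = ENNReal.ofReal D) (h₂ : klDiv Q P₂ = ENNReal.ofReal D) {ε : ℝ}
    (hε : 0 < ε) :
    ∀ᶠ n : ℕ in atTop, ∀ C : Set (Fin n → X), 1 / 2 * Real.exp (-(n * (D + ε))) ≤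
      (iidLaw P₁).real (prefixMap X n ⁻¹' C) + (iidLaw P₂).real (prefixMap X n ⁻¹' Cᶜ) := by
  have e₁ := eventually_iidLaw_le_exp_mul Q P₁ (by simp [h₁]) hε
  have e₂ := eventually_iidLaw_le_exp_mul Q P₂ (by simp [h₂]) hε
  rw [h₁, ENNReal.toReal_ofReal hD] at e₁
  rw [h₂, ENNReal.toReal_ofReal hD] at e₂
  filter_upwards [e₁, e₂] with n k₁ k₂ C
  have hsum : 1 ≤ (iidLaw Q).real (prefixMap X n ⁻¹' C) +
      (iidLaw Q).real (prefixMap X n ⁻¹' Cᶜ) := by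
    have := measureReal_union_le (μ := iidLaw Q) (prefixMap X n ⁻¹' C) (prefixMap X n ⁻¹' Cᶜ)
    rw [Set.preimage_compl, Set.union_compl_self, probReal_univ] at this
    rwa [Set.preimage_compl]
  have hC := k₁ C
  have hC' := k₂ Cᶜ
  rw [Real.exp_neg, ← div_eq_mul_inv, div_le_iff₀ (Real.exp_pos _)]
  -- Adding the two bounds gives 1 ≤ e^(n(D+ε)) · (sum of the errors) + 1/4 + 1/4.
  linarith

end Converse

/-! ### Chernoff's bound and the comparison of the regions -/

section Chernoff

/-- The tilt weight is multiplicative over letters, so the sum over words is the expansion of an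
n-th power. -/
lemma sum_prod_tiltWeight {X : Type*} [Fintype X] [MeasurableSpace X] (P₁ P₂ : Measure X)
    (l : ℝ) (n : ℕ) :
    ∑ v : Fin n → X, (∏ i, P₁.real {v i}) ^ (1 - l) * (∏ i, P₂.real {v i}) ^ l =
      tiltNormalizer P₁ P₂ l ^ n := by
  classical
  rw [tiltNormalizer, Finset.sum_pow']
  refine Finset.sum_congr (by simp) fun v _ => ?_
  rw [← Real.finsetProd_rpow _ _ fun i _ => measureReal_nonneg,
    ← Real.finsetProd_rpow _ _ fun i _ => measureReal_nonneg, ← Finset.prod_mul_distrib]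

/-- Absorbs the overflow probability in the error bound: both terms are at most e^(-(E-δ/2)n), and
the other half of δ pays for the factor 2. -/
lemma add_exp_le_exp_of_le {E γ δ : ℝ} {n : ℕ} (hE : E ≤ γ) (hδ : 0 < δ)
    (hn : 2 * Real.exp (-(E - δ / 2) * n) ≤ Real.exp (-(E - δ) * n)) {a b : ℝ}
    (ha : a ≤ Real.exp (-(E - δ / 2) * n)) (hb : b ≤ Real.exp (-γ * n)) :
    a + b ≤ Real.exp (-(E - δ) * n) := by
  have : Real.exp (-γ * n) ≤ Real.exp (-(E - δ / 2) * n) :=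
    Real.exp_le_exp.2 (mul_le_mul_of_nonneg_right (by linarith) n.cast_nonneg)
  linarith

lemma eventually_const_mul_exp_le {c a b : ℝ} (hab : a < b) :
    ∀ᶠ n : ℕ in atTop, c * Real.exp (-b * n) ≤ Real.exp (-a * n) := by
  have ht : Tendsto (fun n : ℕ => Real.exp ((b - a) * n)) atTop atTop :=
    Real.tendsto_exp_atTop.comp
      (tendsto_natCast_atTop_atTop.const_mul_atTop (sub_pos.2 hab))
  filter_upwards [ht.eventually_ge_atTop c] with n hn
  calc c * Real.exp (-b * n) ≤ Real.exp ((b - a) * n) * Real.exp (-b * n) := by gcongr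
    _ = Real.exp (-a * n) := by rw [← Real.exp_add]; ring_nf

lemma min_le_rpow_mul_rpow {a b l : ℝ} (ha : 0 ≤ a) (hb : 0 ≤ b) (h0 : 0 ≤ l) (h1 : l ≤ 1) :
    min a b ≤ a ^ (1 - l) * b ^ l := by
  have hm : 0 ≤ min a b := le_min ha hb
  calc min a b = min a b ^ (1 - l) * min a b ^ l := by
        rw [← Real.rpow_add_of_nonneg hm (by linarith) h0]
        simp
    _ ≤ a ^ (1 - l) * b ^ l := by
        gcongr
        · exact min_le_left _ _
        · exact min_le_right _ _

variable {X : Type*} [Fintype X] [MeasurableSpace X] [MeasurableSingletonClass X]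
  (P₁ P₂ : Measure X) [IsProbabilityMeasure P₁] [IsProbabilityMeasure P₂]

/-- Chernoff's bound for the maximum likelihood test. -/
lemma exists_set_error_le_tiltNormalizer_pow {l : ℝ} (h0 : 0 ≤ l) (h1 : l ≤ 1) (n : ℕ) :
    ∃ C : Set (Fin n → X),
      (iidLaw P₁).real (prefixMap X n ⁻¹' C) ≤ tiltNormalizer P₁ P₂ l ^ n ∧
      (iidLaw P₂).real (prefixMap X n ⁻¹' Cᶜ) ≤ tiltNormalizer P₁ P₂ l ^ n := by
  classical
  have hnn : ∀ (P : Measure X) (v : Fin n → X), 0 ≤ ∏ i, P.real {v i} := fun P v =>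
    Finset.prod_nonneg fun i _ => measureReal_nonneg
  have hmin : ∀ v : Fin n → X, min (∏ i, P₁.real {v i}) (∏ i, P₂.real {v i}) ≤
      (∏ i, P₁.real {v i}) ^ (1 - l) * (∏ i, P₂.real {v i}) ^ l := fun v =>
    min_le_rpow_mul_rpow (hnn P₁ v) (hnn P₂ v) h0 h1
  have hpos : ∀ v : Fin n → X,
      0 ≤ (∏ i, P₁.real {v i}) ^ (1 - l) * (∏ i, P₂.real {v i}) ^ l := fun v =>
    mul_nonneg (Real.rpow_nonneg (hnn P₁ v) _) (Real.rpow_nonneg (hnn P₂ v) _)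
  -- On either side of the maximum likelihood test, the error counts the smaller of the two
  -- likelihoods.
  refine ⟨{v | ∏ i, P₁.real {v i} ≤ ∏ i, P₂.real {v i}}, ?_, ?_⟩
  all_goals
    rw [iidLaw_prefix, ← sum_prod_tiltWeight]
    refine le_trans (Finset.sum_le_sum fun v hv => ?_)
      (Finset.sum_le_sum_of_subset_of_nonneg (Finset.subset_univ _) fun v _ _ => hpos v)
    refine le_trans ?_ (hmin v)
    have hv' := (@Set.mem_toFinset _ _ (_) _).1 hv
  · exact le_min le_rfl hv'
  · exact le_min (not_le.1 (show ¬ (∏ i, P₁.real {v i} ≤ ∏ i, P₂.real {v i}) from hv')).le le_rfl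

variable {P₁ P₂}

lemma IsChernoffExponent.tiltNormalizer_pos {D : ℝ} (hD : IsChernoffExponent P₁ P₂ D) (l : ℝ) :
    0 < tiltNormalizer P₁ P₂ l := by
  obtain ⟨l', -, hZ, -, h₁, h₂⟩ := hD
  have := isProbabilityMeasure_tilted P₁ P₂ l' hZ
  exact AFLTest.tiltNormalizer_pos (tilted P₁ P₂ l') P₁ P₂ (by simp [h₁]) (by simp [h₂]) l

lemma IsChernoffExponent.neg_log_tiltNormalizer_le {D : ℝ} (hD : IsChernoffExponent P₁ P₂ D)
    (l : ℝ) : -Real.log (tiltNormalizer P₁ P₂ l) ≤ D := by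
  obtain ⟨l', -, hZ, hD0, h₁, h₂⟩ := hD
  have := isProbabilityMeasure_tilted P₁ P₂ l' hZ
  have h := AFLTest.neg_log_tiltNormalizer_le (tilted P₁ P₂ l') P₁ P₂ (by simp [h₁]) (by simp [h₂]) l
  rw [h₁, h₂, ENNReal.toReal_ofReal hD0] at h
  linarith

lemma IsChernoffExponent.exists_tiltNormalizer_eq {D : ℝ} (hD : IsChernoffExponent P₁ P₂ D) :
    ∃ l ∈ Set.Icc (0 : ℝ) 1, tiltNormalizer P₁ P₂ l = Real.exp (-D) := by
  obtain ⟨l, hl, hZ, hD0, h₁, h₂⟩ := hD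
  refine ⟨l, hl, ?_⟩
  have h := convexComb_klDiv_tilted P₁ P₂ hZ (by simp [h₁]) (by simp [h₂])
  rw [h₁, h₂, ENNReal.toReal_ofReal hD0] at h
  rw [← Real.exp_log hZ]
  congr 1
  linarith

/-- Exponent pairs below the Chernoff exponent are achievable. -/
lemma IsChernoffExponent.flAchievable {D : ℝ} (hD : IsChernoffExponent P₁ P₂ D) {E₁ E₂ : ℝ}
    (h₁ : E₁ ≤ D) (h₂ : E₂ ≤ D) : FLAchievable P₁ P₂ E₁ E₂ := by
  obtain ⟨l, hl, hZ⟩ := hD.exists_tiltNormalizer_eq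
  refine flAchievable_of_eventually_exists_set P₁ P₂ fun δ hδ => .of_forall fun n => ?_
  obtain ⟨C, hC₁, hC₂⟩ := exists_set_error_le_tiltNormalizer_pow P₁ P₂ hl.1 hl.2 n
  rw [hZ, ← Real.exp_nat_mul, mul_comm] at hC₁ hC₂
  refine ⟨C, hC₁.trans (Real.exp_le_exp.2 ?_), hC₂.trans (Real.exp_le_exp.2 ?_)⟩ <;>
    exact mul_le_mul_of_nonneg_right (by linarith) n.cast_nonneg

/-- If `P^(l)` is farther than the Chernoff exponent from one hypothesis, it is within that
exponent of the other. -/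
lemma IsChernoffExponent.klDiv_tilted_le {D γ l : ℝ} (hD : IsChernoffExponent P₁ P₂ D)
    (hγ : D < γ) (hl : l ∈ Set.Icc (0 : ℝ) 1) :
    (ENNReal.ofReal γ ≤ klDiv (tilted P₁ P₂ l) P₂ →
      klDiv (tilted P₁ P₂ l) P₁ ≤ ENNReal.ofReal D) ∧
    (ENNReal.ofReal γ ≤ klDiv (tilted P₁ P₂ l) P₁ →
      klDiv (tilted P₁ P₂ l) P₂ ≤ ENNReal.ofReal D) := by
  have hγ0 : 0 < γ := by
    obtain ⟨-, -, -, hD0, -⟩ := hD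
    linarith
  -- At an endpoint P^(l) is one of the hypotheses and its divergence from the other may be
  -- infinite, so the convexity argument is confined to interior l.
  rcases hl.1.eq_or_lt with rfl | h0
  · rw [tilted_zero, klDiv_self]
    refine ⟨fun _ => zero_le, fun h => absurd h ?_⟩
    simpa using hγ0
  rcases hl.2.eq_or_lt with rfl | h1
  · rw [tilted_one, klDiv_self]
    refine ⟨fun h => absurd h ?_, fun _ => zero_le⟩
    simpa using hγ0
  have hZ := hD.tiltNormalizer_pos l
  obtain ⟨t₁, t₂⟩ := klDiv_tilted_ne_top P₁ P₂ hZ h0 h1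
  have hconv := convexComb_klDiv_tilted P₁ P₂ hZ t₁ t₂
  have hle := hD.neg_log_tiltNormalizer_le l
  constructor <;> intro h
  · rw [ENNReal.ofReal_le_iff_le_toReal t₂] at h
    rw [ENNReal.le_ofReal_iff_toReal_le t₁ hD.choose_spec.2.2.1]
    -- Otherwise both divergences exceed `D`, hence so does their weighted mean, which is -log Z(l)
    -- ≤ `D`.
    by_contra! hlt
    nlinarith [mul_lt_mul_of_pos_left hlt (sub_pos.2 h1),
      mul_lt_mul_of_pos_left (hγ.trans_le h) h0]
  · rw [ENNReal.ofReal_le_iff_le_toReal t₁] at h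
    rw [ENNReal.le_ofReal_iff_toReal_le t₂ hD.choose_spec.2.2.1]
    by_contra! hlt
    nlinarith [mul_lt_mul_of_pos_left hlt h0,
      mul_lt_mul_of_pos_left (hγ.trans_le h) (sub_pos.2 h1)]

lemma IsChernoffExponent.gammaBox_subset_regionFL {D γ : ℝ} (hD : IsChernoffExponent P₁ P₂ D)
    (hγ : D < γ) : gammaBox P₁ P₂ γ ⊆ regionFL P₁ P₂ := by
  have hD0 : 0 ≤ D := hD.choose_spec.2.2.1
  -- Nonnegativity of `D` lets the bound pass from `ENNReal` to the reals. It also covers an empty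
  -- supremum, whose value is 0.
  have key : ∀ {e : ENNReal} {E : ℝ}, e ≤ ENNReal.ofReal D → (E : EReal) ≤ (e : EReal) → E ≤ D := by
    intro e E he hE
    have := hE.trans (EReal.coe_ennreal_le_coe_ennreal_iff.2 he)
    rw [EReal.coe_ennreal_ofReal, max_eq_left hD0] at this
    exact_mod_cast this
  rintro ⟨E₁, E₂⟩ ⟨h₁, h₂⟩
  refine hD.flAchievable (key (sSup_le ?_) h₁) (key (sSup_le ?_) h₂)
  · rintro d ⟨l, hl, h, rfl⟩
    exact (hD.klDiv_tilted_le hγ hl).1 h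
  · rintro d ⟨l, hl, h, rfl⟩
    exact (hD.klDiv_tilted_le hγ hl).2 h

lemma IsChernoffExponent.regionAFL_subset_regionFL {D γ : ℝ} (hD : IsChernoffExponent P₁ P₂ D)
    (hγ : D < γ) (K : ℕ) : regionAFL P₁ P₂ γ K ⊆ regionFL P₁ P₂ := by
  rintro ⟨E₁, E₂⟩ h
  by_cases hE₂ : E₂ ≤ γ
  · refine flAchievable_of_eventually_exists_set P₁ P₂ fun δ hδ => ?_
    obtain ⟨N, hN⟩ := h (δ / 2) (half_pos hδ)
    filter_upwards [eventually_ge_atTop N, eventually_const_mul_exp_le (c := 2)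
      (show E₂ - δ < E₂ - δ / 2 by linarith)] with n hn hexp
    obtain ⟨T, -, hτ, -, hK, ha, hb⟩ := hN n hn
    -- Undecided sequences go to H₁, which burdens only the error under P₂; this is affordable since
    -- E₂ ≤ γ.
    obtain ⟨C, hC₁, hC₂⟩ := exists_set_truncate₁ P₁ P₂ T n (ae_exists_eq_natCast hK)
    refine ⟨C, hC₁.trans (ha.trans (Real.exp_le_exp.2 ?_)), hC₂.trans ?_⟩
    · exact mul_le_mul_of_nonneg_right (by dsimp only; linarith) n.cast_nonneg
    · exact add_exp_le_exp_of_le hE₂ hδ hexp hb hτ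
  by_cases hE₁ : E₁ ≤ γ
  · refine flAchievable_of_eventually_exists_set P₁ P₂ fun δ hδ => ?_
    obtain ⟨N, hN⟩ := h (δ / 2) (half_pos hδ)
    filter_upwards [eventually_ge_atTop N, eventually_const_mul_exp_le (c := 2)
      (show E₁ - δ < E₁ - δ / 2 by linarith)] with n hn hexp
    obtain ⟨T, hτ, -, hK, -, ha, hb⟩ := hN n hn
    obtain ⟨C, hC₁, hC₂⟩ := exists_set_truncate₂ P₁ P₂ T n (ae_exists_eq_natCast hK)
    refine ⟨C, hC₁.trans ?_, hC₂.trans (hb.trans (Real.exp_le_exp.2 ?_))⟩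
    · exact add_exp_le_exp_of_le hE₁ hδ hexp ha hτ
    · exact mul_le_mul_of_nonneg_right (by dsimp only; linarith) n.cast_nonneg
  exfalso
  push Not at hE₁ hE₂
  obtain ⟨l, -, hZ, hD0, h₁, h₂⟩ := hD
  have := isProbabilityMeasure_tilted P₁ P₂ l hZ
  -- Leaves a gap between the exponents `D + δ` of the lower bound and `γ - δ` of the upper bound.
  -- The upper bound has three terms (two errors and one overflow), so half an exponential is at
  -- most three others; any constant above 6, here 7, yields the contradiction.
  set δ := (γ - D) / 4 with hδ
  have hδ0 : 0 < δ := by rw [hδ]; linarith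
  obtain ⟨N, hN⟩ := h δ hδ0
  have hlow := eventually_half_exp_le_error_sum (tilted P₁ P₂ l) P₁ P₂ hD0 h₁ h₂ hδ0
  obtain ⟨n, hnN, hlow, hexp⟩ := ((eventually_ge_atTop N).and (hlow.and
    (eventually_const_mul_exp_le (c := 7) (show D + δ < γ - δ by linarith)))).exists
  obtain ⟨T, -, hτ, -, hK, ha, hb⟩ := hN n hnN
  obtain ⟨C, hC₁, hC₂⟩ := exists_set_truncate₁ P₁ P₂ T n (ae_exists_eq_natCast hK)
  have hlow := hlow C
  have hmono : ∀ e : ℝ, γ - δ ≤ e → Real.exp (-e * n) ≤ Real.exp (-(γ - δ) * n) := fun e he =>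
    Real.exp_le_exp.2 (mul_le_mul_of_nonneg_right (by linarith) n.cast_nonneg)
  have m₁ := hmono (E₁ - δ) (by linarith)
  have m₂ := hmono (E₂ - δ) (by linarith)
  have m₃ := hmono γ (by linarith)
  rw [show -((n : ℝ) * (D + δ)) = -(D + δ) * n by ring] at hlow
  have hpos := Real.exp_pos (-(γ - δ) * n)
  dsimp only at ha hb
  linarith

end Chernoff

end AFLTest

theorem mainTheorem10 {X : Type*} [Fintype X] [MeasurableSpace X] [MeasurableSingletonClass X]
    (P₁ P₂ : MeasureTheory.Measure X)
    [MeasureTheory.IsProbabilityMeasure P₁] [MeasureTheory.IsProbabilityMeasure P₂]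
    (Dstar : ℝ) (hD : AFLTest.IsChernoffExponent P₁ P₂ Dstar)
    (γ : ℝ) (hγ : Dstar < γ) :
    (∀ K : ℕ, 1 ≤ K → AFLTest.regionAFL P₁ P₂ γ K = AFLTest.regionFL P₁ P₂) ∧
      AFLTest.gammaBox P₁ P₂ γ ⊆ AFLTest.regionFL P₁ P₂ := by
  exact ⟨fun K hK => (hD.regionAFL_subset_regionFL hγ K).antisymm
    (AFLTest.regionFL_subset_regionAFL P₁ P₂ γ hK), hD.gammaBox_subset_regionFL hγ⟩
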